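/- Let $r\ge 2$ be an integer and let $\epsilon>0$. Then there exists an infinite set $A$ of positive integers which contains no Hilbert cube of dimension $r$, i.e. no sumset $$L_1+\cdots+L_r=\{\lambda_1+\cdots+\lambda_r:\ \lambda_i\in L_i,\ i=1,\dots,r\}$$ with $L_1,\dots,L_r\subset\mathbb Z$ and $|L_1|=\cdots=|L_r|=2$ (the $2^r$ sums need not be distinct), and whose counting function $A(x)=|A\cap[1,x]|$ satisfies $$A(x)\gg x^{1-\frac{r}{2^r-1}-\epsilon}\qquad (x\to\infty),$$ that is, there are constants $c>0$ and $x_0$ (which may depend on $r$, $\epsilon$ and $A$) with $A(x)\ge c\,x^{1-\frac{r}{2^r-1}-\epsilon}$ for all real $x\ge x_0$. -/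

import Mathlib

/-- The sumset `L₁ + ⋯ + L_r` of finitely many finite subsets of an abelian group. -/
def familySumset {G : Type*} [AddCommGroup G] {r : ℕ} (L : Fin r → Finset G) : Set G :=
  {x | ∃ l : Fin r → G, (∀ i, l i ∈ L i) ∧ x = ∑ i, l i}

/-- `A` is `𝓛^{(r)}_{ℓ₁,…,ℓ_r}`-free: it contains no sumset `L₁ + ⋯ + L_r` with `|L_i| = ℓ_i`
for all `i`. The sums need not be pairwise distinct. -/
def IsSumsetFree {G : Type*} [AddCommGroup G] {r : ℕ} (ℓ : Fin r → ℕ) (A : Set G) : Prop :=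
  ∀ L : Fin r → Finset G, (∀ i, (L i).card = ℓ i) → ¬ familySumset L ⊆ A

/-- `A` is free of Hilbert cubes of dimension `r`, that is, of sumsets of `r` two-element sets. -/
def IsHilbertCubeFree {G : Type*} [AddCommGroup G] (r : ℕ) (A : Set G) : Prop :=
  IsSumsetFree (fun _ : Fin r => 2) A

/-- The counting function `A(x) = |A ∩ [1, x]|` of a set of integers. -/
noncomputable def countingFun (A : Set ℤ) (x : ℝ) : ℕ :=
  {a : ℤ | a ∈ A ∧ 1 ≤ a ∧ (a : ℝ) ≤ x}.ncard

open Finset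

/-! The proof is the deletion method, run inside a set without three-term progressions. In such a
set a cube with positive edges has 2^r distinct points, so degenerate cubes never have to be
counted, and by `Behrend.roth_lower_bound` the restriction costs only a factor N^δ.

Put N = 4^k and α = r/(2^r - 1). In an interval of length N take at least a constant times N^(1-δ)
such points, cut them into groups of about N^(α+δ), and draw one point from each group. A cube
survives with probability at most ∏ 3n^(-(α+δ)) over its points n. The point indexed by a nonempty S
is at least d_i for each i ∈ S. Sharing the exponent α equally among these edges gives each d_i the
total exponent α ∑_{S ∋ i} 1/|S| = 1. Hence the edges contribute only logarithms, and the sum over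
lowest points is N^(1-α-2^r δ) up to logarithms. Since 2^r ≥ 4, this is smaller by a power of N than
the number of points drawn, which is at least of order N^(1-α-2δ).

The ratios are summable over k, so one choice serves all blocks of a finite range far enough out,
and deleting the top point of each surviving cube leaves at least half of each block's selection. An
ultrafilter limit removes the finiteness of the range. -/

/-! ### Hilbert cubes and their nondegeneracy -/

/-- The points of the Hilbert cube with lowest point `a` and edges `d i`. -/
def cubePoint {r : ℕ} (a : ℕ) (d : Fin r → ℕ) (S : Finset (Fin r)) : ℕ := a + ∑ i ∈ S, d i

theorem cubePoint_injective_of_threeAPFree {r : ℕ} {a : ℕ} {d : Fin r → ℕ} {B : Set ℕ}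
    (hB : ThreeAPFree B) (hd : ∀ i, 0 < d i) (h : ∀ S, cubePoint a d S ∈ B) :
    Function.Injective (cubePoint a d) := by
  intro S T hST
  have h1 : ∑ i ∈ S \ T, d i + ∑ i ∈ S ∩ T, d i = ∑ i ∈ S, d i :=
    sdiff_inter_self_left S T ▸ sum_sdiff inter_subset_left
  have h2 : ∑ i ∈ T \ S, d i + ∑ i ∈ T ∩ S, d i = ∑ i ∈ T, d i :=
    sdiff_inter_self_left T S ▸ sum_sdiff inter_subset_left
  rw [inter_comm] at h2
  have h3 : ∑ i ∈ (S \ T) ∪ (T \ S), d i = ∑ i ∈ S \ T, d i + ∑ i ∈ T \ S, d i :=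
    sum_union disjoint_sdiff_sdiff
  simp only [cubePoint] at hST
  -- If S and T give the same point, then S \ T and T \ S have equal edge sums, so these three
  -- points form a progression; its difference must vanish.
  have h4 := hB (h ∅) (h (S \ T)) (h ((S \ T) ∪ (T \ S))) (by
    simp only [cubePoint, h3, sum_empty]; omega)
  simp only [cubePoint, sum_empty] at h4
  have e1 : ∑ i ∈ S \ T, d i = 0 := by omega
  have e2 : ∑ i ∈ T \ S, d i = 0 := by omega
  rw [sum_eq_zero_iff] at e1 e2
  apply subset_antisymm
  · intro i hi
    by_contra hn
    exact (hd i).ne' (e1 i (by simp [hi, hn]))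
  · intro i hi
    by_contra hn
    exact (hd i).ne' (e2 i (by simp [hi, hn]))

theorem isHilbertCubeFree_image_natCast {r : ℕ} {A : Set ℕ}
    (h : ∀ (a : ℕ) (d : Fin r → ℕ), (∀ i, 0 < d i) → ¬ ∀ S, cubePoint a d S ∈ A) :
    IsHilbertCubeFree r ((fun n : ℕ => (n : ℤ)) '' A) := by
  intro L hL hsub
  have hex : ∀ i, ∃ x y : ℤ, x < y ∧ x ∈ L i ∧ y ∈ L i := by
    intro i
    obtain ⟨x, y, hxy, hE⟩ := card_eq_two.1 (hL i)
    rcases lt_or_gt_of_ne hxy with hlt | hlt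
    · exact ⟨x, y, hlt, by simp [hE], by simp [hE]⟩
    · exact ⟨y, x, hlt, by simp [hE], by simp [hE]⟩
  choose x y hxy hx hy using hex
  -- The summands may be negative, but the lowest sum lies in the image of ℕ.
  obtain ⟨a, -, ha⟩ := hsub (⟨x, hx, rfl⟩ : ∑ i, x i ∈ familySumset L)
  refine h a (fun i => (y i - x i).toNat) (fun i => by have := hxy i; omega) ?_
  intro S
  obtain ⟨b, hb, hbe⟩ := hsub (⟨fun i => if i ∈ S then y i else x i,
    fun i => by by_cases hi : i ∈ S <;> simp [hi, hx, hy], rfl⟩ :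
    ∑ i, (if i ∈ S then y i else x i) ∈ familySumset L)
  have : (cubePoint a (fun i => (y i - x i).toNat) S : ℤ) = b := by
    simp only [cubePoint] at ha hbe ⊢
    push_cast
    rw [hbe, ha]
    have : ∀ i, (if i ∈ S then y i else x i) = x i + if i ∈ S then y i - x i else 0 := by
      intro i; split_ifs <;> ring
    simp only [this, sum_add_distrib]
    congr 1
    rw [← sum_filter]
    simp only [filter_mem_eq_inter, univ_inter]
    refine sum_congr rfl fun i _ => ?_
    have := hxy i
    omega
  have h' : cubePoint a (fun i => (y i - x i).toNat) S = b := by exact_mod_cast this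
  rw [h']; exact hb

/-! ### Random transversals of disjoint groups -/

/-- Choices in different groups are independent, so the probability of catching `e` factors over the
groups: 1 if `e` misses the group, 1/|G i| if it meets it once, 0 if it meets it more often. Drawing
one point per group also fixes the sample size, so no concentration estimate is needed. -/
theorem card_piFinset_filter_subset_image_le {ι α : Type*} [Fintype ι] [DecidableEq ι]
    [DecidableEq α] (G : ι → Finset α) (hG : ∀ i, (G i).Nonempty)
    (hdisj : ∀ i j, i ≠ j → Disjoint (G i) (G j)) (p : α → ℝ) (hp0 : ∀ n, 0 ≤ p n)
    (hp : ∀ i, ∀ n ∈ G i, 1 / (#(G i) : ℝ) ≤ p n) (e : Finset α) :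
    (#{f ∈ Fintype.piFinset G | e ⊆ univ.image f} : ℝ) ≤
      #(Fintype.piFinset G) * ∏ n ∈ e, p n := by
  by_cases hcov : ∀ n ∈ e, ∃ i, n ∈ G i
  · have hsub : {f ∈ Fintype.piFinset G | e ⊆ univ.image f} ⊆
        Fintype.piFinset fun i => {x ∈ G i | ∀ n ∈ e, n ∈ G i → x = n} := by
      intro f hf
      simp only [mem_filter, Fintype.mem_piFinset] at hf ⊢
      intro i
      refine ⟨hf.1 i, fun n hn hni => ?_⟩
      obtain ⟨j, -, hj⟩ := mem_image.1 (hf.2 hn)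
      by_cases hij : i = j
      · rw [hij, hj]
      · exact absurd hni (disjoint_right.1 (hdisj i j hij) (hj ▸ hf.1 j))
    have hpart : ∏ n ∈ e, p n = ∏ i, ∏ n ∈ e with n ∈ G i, p n := by
      rw [← prod_biUnion]
      · congr 1
        ext n
        simp only [mem_biUnion, mem_univ, mem_filter, true_and]
        exact ⟨fun h => (hcov n h).imp fun i hi => ⟨h, hi⟩, fun ⟨i, h, _⟩ => h⟩
      · intro i _ j _ hij
        refine disjoint_left.2 fun n h1 h2 => ?_
        exact disjoint_left.1 (hdisj i j hij) (mem_filter.1 h1).2 (mem_filter.1 h2).2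
    calc (#{f ∈ Fintype.piFinset G | e ⊆ univ.image f} : ℝ)
        ≤ #(Fintype.piFinset fun i => {x ∈ G i | ∀ n ∈ e, n ∈ G i → x = n}) := by
          exact_mod_cast card_le_card hsub
      _ = ∏ i, (#{x ∈ G i | ∀ n ∈ e, n ∈ G i → x = n} : ℝ) := by
          rw [Fintype.card_piFinset]; push_cast; rfl
      _ ≤ ∏ i, ((#(G i) : ℝ) * ∏ n ∈ e with n ∈ G i, p n) := by
          refine prod_le_prod (fun _ _ => by positivity) fun i _ => ?_
          have hGpos : (0 : ℝ) < #(G i) := by exact_mod_cast (hG i).card_pos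
          rcases ({n ∈ e | n ∈ G i}).eq_empty_or_nonempty with h0 | ⟨n, hn⟩
          · rw [h0, prod_empty, mul_one]
            exact_mod_cast card_filter_le _ _
          · by_cases h1 : {n ∈ e | n ∈ G i} = {n}
            · rw [h1, prod_singleton]
              have hle : (#{x ∈ G i | ∀ n ∈ e, n ∈ G i → x = n} : ℝ) ≤ 1 := by
                have : #{x ∈ G i | ∀ n ∈ e, n ∈ G i → x = n} ≤ 1 := by
                  rw [card_le_one]
                  intro x hx y hy
                  have hn' := mem_filter.1 hn
                  rw [(mem_filter.1 hx).2 n hn'.1 hn'.2, (mem_filter.1 hy).2 n hn'.1 hn'.2]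
                exact_mod_cast this
              have h2 := hp i n (mem_filter.1 hn).2
              rw [div_le_iff₀ hGpos] at h2
              linarith
            · have : {x ∈ G i | ∀ n ∈ e, n ∈ G i → x = n} = ∅ := by
                rw [eq_empty_iff_forall_notMem]
                intro x hx
                apply h1
                have hx' := (mem_filter.1 hx).2
                ext m
                constructor
                · intro hm
                  have hm' := mem_filter.1 hm
                  have hn' := mem_filter.1 hn
                  rw [mem_singleton, ← hx' m hm'.1 hm'.2, ← hx' n hn'.1 hn'.2]
                · intro hm
                  rw [mem_singleton.1 hm]; exact hn
              rw [this]
              simp only [card_empty, Nat.cast_zero]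
              exact mul_nonneg hGpos.le (prod_nonneg fun _ _ => hp0 _)
      _ = _ := by
          rw [prod_mul_distrib, hpart, Fintype.card_piFinset]; push_cast; rfl
  · push Not at hcov
    obtain ⟨n, hn, hni⟩ := hcov
    have : {f ∈ Fintype.piFinset G | e ⊆ univ.image f} = ∅ := by
      rw [eq_empty_iff_forall_notMem]
      intro f hf
      rw [mem_filter, Fintype.mem_piFinset] at hf
      obtain ⟨j, -, hj⟩ := mem_image.1 (hf.2 hn)
      exact hni j (hj ▸ hf.1 j)
    rw [this]
    simp only [card_empty, Nat.cast_zero]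
    exact mul_nonneg (by positivity) (prod_nonneg fun _ _ => hp0 _)

/-- First-moment argument: some transversal does no worse than the average. -/
theorem exists_transversal_weight_le {ι α κ : Type*} [Fintype ι] [DecidableEq ι]
    [DecidableEq α] (G : ι → Finset α) (hG : ∀ i, (G i).Nonempty)
    (hdisj : ∀ i j, i ≠ j → Disjoint (G i) (G j)) (p : α → ℝ) (hp0 : ∀ n, 0 ≤ p n)
    (hp : ∀ i, ∀ n ∈ G i, 1 / (#(G i) : ℝ) ≤ p n) (E : Finset κ) (e : κ → Finset α)
    (w : κ → ℝ) (hw : ∀ x, 0 ≤ w x) :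
    ∃ f : ι → α, (∀ i, f i ∈ G i) ∧
      ∑ x ∈ E with e x ⊆ univ.image f, w x ≤ ∑ x ∈ E, w x * ∏ n ∈ e x, p n := by
  have hne : (Fintype.piFinset G).Nonempty := Fintype.piFinset_nonempty.2 hG
  obtain ⟨f, hf, hle⟩ := exists_le_of_sum_le (s := Fintype.piFinset G)
    (f := fun f => ∑ x ∈ E with e x ⊆ univ.image f, w x)
    (g := fun _ => ∑ x ∈ E, w x * ∏ n ∈ e x, p n) hne (by
      rw [sum_const, nsmul_eq_mul, mul_sum]
      simp only [sum_filter]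
      rw [sum_comm]
      refine sum_le_sum fun x _ => ?_
      rw [← sum_filter, sum_const, nsmul_eq_mul]
      have := mul_le_mul_of_nonneg_left
        (card_piFinset_filter_subset_image_le G hG hdisj p hp0 hp (e x)) (hw x)
      linarith)
  exact ⟨f, Fintype.mem_piFinset.1 hf, hle⟩

theorem exists_disjoint_subsets_card_eq {α : Type*} [DecidableEq α] (s m : ℕ) (B : Finset α)
    (h : m * s ≤ #B) :
    ∃ G : Fin m → Finset α, (∀ j, G j ⊆ B) ∧ (∀ j, #(G j) = s) ∧
      ∀ i j, i ≠ j → Disjoint (G i) (G j) := by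
  induction m generalizing B with
  | zero => exact ⟨Fin.elim0, fun j => j.elim0, fun j => j.elim0, fun j => j.elim0⟩
  | succ m ih =>
    obtain ⟨C, hC, hCs⟩ := exists_subset_card_eq (s := B) (n := s) (by nlinarith)
    obtain ⟨G, h1, h2, h3⟩ := ih (B \ C) (by
      rw [card_sdiff_of_subset hC, hCs]; rw [add_mul] at h; omega)
    have hCG : ∀ j, Disjoint C (G j) := fun j =>
      disjoint_of_subset_right (h1 j) disjoint_sdiff
    refine ⟨Fin.cons C G, ?_, ?_, ?_⟩
    · intro j
      refine Fin.cases ?_ (fun j => ?_) j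
      · simpa using hC
      · simpa using (h1 j).trans sdiff_subset
    · intro j
      refine Fin.cases ?_ (fun j => ?_) j
      · simpa using hCs
      · simpa using h2 j
    · intro i j
      refine Fin.cases ?_ (fun i => ?_) i <;> refine Fin.cases ?_ (fun j => ?_) j
      · simp
      · intro _; simpa using hCG j
      · intro _; simpa using (hCG i).symm
      · intro hij
        simpa using h3 i j (by simpa using hij)

/-! ### Separated blocks -/

theorem threeAPFree_iUnion_blocks {B : ℕ → Finset ℕ}
    (hB : ∀ k, B k ⊆ Ico (2 * 4 ^ k) (3 * 4 ^ k)) (h3 : ∀ k, ThreeAPFree (B k : Set ℕ)) :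
    ThreeAPFree (⋃ k, (B k : Set ℕ)) := by
  have key : ∀ {x y k l : ℕ}, x ∈ B k → y ∈ B l → k < l → 4 * x < 3 * 4 ^ l ∧ 2 * 4 ^ l ≤ y := by
    intro x y k l hx hy hkl
    have hx' := mem_Ico.1 (hB k hx)
    have hy' := mem_Ico.1 (hB l hy)
    have h : 4 ^ (k + 1) ≤ 4 ^ l := Nat.pow_le_pow_right (by norm_num) hkl
    rw [pow_succ] at h
    omega
  have main : ∀ {x y z : ℕ}, x ∈ (⋃ k, (B k : Set ℕ)) → y ∈ (⋃ k, (B k : Set ℕ)) →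
      z ∈ (⋃ k, (B k : Set ℕ)) → x + z = y + y → x ≤ y → x = y := by
    intro x y z hx hy hz hxyz hle
    simp only [Set.mem_iUnion, mem_coe] at hx hy hz
    obtain ⟨i, hi⟩ := hx
    obtain ⟨j, hj⟩ := hy
    obtain ⟨k, hk⟩ := hz
    have bi := mem_Ico.1 (hB i hi)
    have bj := mem_Ico.1 (hB j hj)
    have bk := mem_Ico.1 (hB k hk)
    -- With x ≤ y ≤ z: a higher block for z would give z > 2y. Once y and z share block j, x = 2y -
    -- z > 4^j, which is too large for any lower block.
    have hjk : j = k := by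
      rcases lt_trichotomy j k with h | h | h
      · have := key hj hk h; omega
      · exact h
      · have := key hk hj h; omega
    subst hjk
    have hij : i = j := by
      rcases lt_trichotomy i j with h | h | h
      · have := key hi hj h; omega
      · exact h
      · have := key hj hi h; omega
    subst hij
    exact h3 i hi hj hk hxyz
  intro x hx y hy z hz hxyz
  rcases le_total x y with h | h
  · exact main hx hy hz hxyz h
  · have := main hz hy hx (by omega) (by omega)
    omega

/-! ### Weighted count of cubes -/

/-- The sum does not depend on `i` by symmetry, and over all `i` each nonempty S contributes 1. This
is where the critical exponent r/(2^r - 1) comes from. -/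
theorem sum_inv_card_of_mem {r : ℕ} (i : Fin r) :
    ∑ S : Finset (Fin r), (if i ∈ S then 1 / (#S : ℝ) else 0) = ((2 : ℝ) ^ r - 1) / r := by
  have hr : (0 : ℝ) < r := by exact_mod_cast i.pos
  have hsymm : ∀ j, ∑ S : Finset (Fin r), (if j ∈ S then 1 / (#S : ℝ) else 0) =
      ∑ S : Finset (Fin r), (if i ∈ S then 1 / (#S : ℝ) else 0) := by
    intro j
    rw [← (Equiv.finsetCongr (Equiv.swap i j)).sum_comp]
    refine sum_congr rfl fun S _ => ?_
    simp [Equiv.finsetCongr_apply, mem_map_equiv]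
  have htot : ∑ j : Fin r, ∑ S : Finset (Fin r), (if j ∈ S then 1 / (#S : ℝ) else 0) =
      (2 : ℝ) ^ r - 1 := by
    rw [sum_comm]
    have : ∀ S : Finset (Fin r), ∑ j : Fin r, (if j ∈ S then 1 / (#S : ℝ) else 0) =
        1 - if S = ∅ then 1 else 0 := by
      intro S
      rw [← sum_filter, filter_mem_eq_inter, univ_inter, sum_const, nsmul_eq_mul]
      split_ifs with h
      · simp [h]
      · have : (#S : ℝ) ≠ 0 := by simpa using h
        field_simp; ring
    rw [sum_congr rfl fun S _ => this S]
    simp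
  simp only [hsymm, sum_const, card_univ, Fintype.card_fin, nsmul_eq_mul] at htot
  rw [← htot]; field_simp

/-- The point is at least `a`, which handles δ, and at least each `d i` with i ∈ S, each of which
receives an equal share of α. -/
theorem rpow_neg_cubePoint_le {r : ℕ} {a : ℕ} {d : Fin r → ℕ} (ha : 0 < a) (hd : ∀ i, 0 < d i)
    {α δ : ℝ} (hα : 0 ≤ α) (hδ : 0 ≤ δ) {S : Finset (Fin r)} (hS : S ≠ ∅) :
    (cubePoint a d S : ℝ) ^ (-(α + δ)) ≤
      (a : ℝ) ^ (-δ) * ∏ i, (d i : ℝ) ^ (-(α * if i ∈ S then 1 / (#S : ℝ) else 0)) := by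
  have ha' : (0 : ℝ) < a := by exact_mod_cast ha
  have hle : a ≤ cubePoint a d S := Nat.le_add_right _ _
  have hx : (0 : ℝ) < cubePoint a d S := by exact_mod_cast ha.trans_le hle
  have hcard : (#S : ℝ) ≠ 0 := by simpa using hS
  have hsum : ∑ i, (-(α * if i ∈ S then 1 / (#S : ℝ) else 0)) = -α := by
    rw [sum_neg_distrib, ← mul_sum, ← sum_filter, filter_mem_eq_inter, univ_inter, sum_const,
      nsmul_eq_mul]
    field_simp
  rw [neg_add_rev, Real.rpow_add hx, ← hsum, Real.rpow_sum_of_pos hx]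
  refine mul_le_mul ?_ ?_ (by positivity) (by positivity)
  · exact Real.rpow_le_rpow_of_nonpos ha' (by exact_mod_cast hle) (by linarith)
  · refine prod_le_prod (fun i _ => by positivity) fun i _ => ?_
    split_ifs with hi
    · refine Real.rpow_le_rpow_of_nonpos (by exact_mod_cast hd i) ?_ ?_
      · have : d i ≤ cubePoint a d S :=
          (single_le_sum (f := d) (fun _ _ => Nat.zero_le _) hi).trans (Nat.le_add_left _ _)
        exact_mod_cast this
      · have : 0 ≤ α * (1 / (#S : ℝ)) := by positivity
        linarith
    · simp

/-- The weight of a cube for the density `n ^ (-(α + δ))`, where `α` is the critical exponent. -/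
theorem prod_rpow_neg_cubePoint_le {r : ℕ} (hr : 0 < r) {a : ℕ} {d : Fin r → ℕ} (ha : 0 < a)
    (hd : ∀ i, 0 < d i) {α δ : ℝ} (hα : α = r / ((2 : ℝ) ^ r - 1)) (hδ : 0 ≤ δ) :
    ∏ S, (cubePoint a d S : ℝ) ^ (-(α + δ)) ≤
      (a : ℝ) ^ (-(α + δ * 2 ^ r)) * ∏ i, (d i : ℝ)⁻¹ := by
  have ha' : (0 : ℝ) < a := by exact_mod_cast ha
  have hr' : (0 : ℝ) < r := by exact_mod_cast hr
  have hD : (0 : ℝ) < 2 ^ r - 1 := by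
    have := one_lt_pow₀ (M₀ := ℝ) one_lt_two hr.ne'
    linarith
  have hα0 : 0 ≤ α := by rw [hα]; positivity
  have h1 : ∀ S, (cubePoint a d S : ℝ) ^ (-(α + δ)) ≤
      ((a : ℝ) ^ (-δ) * if S = ∅ then (a : ℝ) ^ (-α) else 1) *
        ∏ i, (d i : ℝ) ^ (-(α * if i ∈ S then 1 / (#S : ℝ) else 0)) := by
    intro S
    by_cases hS : S = ∅
    · subst hS
      simp only [cubePoint, sum_empty, add_zero, if_true, notMem_empty, if_false, mul_zero,
        neg_zero, Real.rpow_zero, prod_const_one, mul_one]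
      rw [neg_add_rev, Real.rpow_add ha']
    · rw [if_neg hS, mul_one]
      exact rpow_neg_cubePoint_le ha hd hα0 hδ hS
  refine (prod_le_prod (fun _ _ => by positivity) fun S _ => h1 S).trans (le_of_eq ?_)
  rw [prod_mul_distrib, prod_mul_distrib, prod_comm]
  congr 1
  · rw [prod_ite_eq' univ ∅ (fun _ => (a : ℝ) ^ (-α)), if_pos (mem_univ _), prod_const,
      ← Real.rpow_natCast, ← Real.rpow_mul ha'.le, ← Real.rpow_add ha']
    congr 1
    simp [Fintype.card_finset]
  · refine prod_congr rfl fun i _ => ?_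
    rw [← Real.rpow_sum_of_pos (by exact_mod_cast hd i), sum_neg_distrib, ← mul_sum,
      sum_inv_card_of_mem, hα, ← Real.rpow_neg_one]
    congr 1
    field_simp

theorem sum_prod_cubePoint_le {r : ℕ} (hr : 0 < r) {α δ : ℝ} (hα : α = r / ((2 : ℝ) ^ r - 1))
    (hδ : 0 ≤ δ) (hu : α + δ * 2 ^ r ≤ 1) (M : ℕ) (C : ℝ) (hC : 0 ≤ C) :
    ∑ x ∈ Icc 1 M ×ˢ Fintype.piFinset (fun _ : Fin r => Icc 1 M),
        ∏ S, (C * (cubePoint x.1 x.2 S : ℝ) ^ (-(α + δ))) ≤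
      C ^ 2 ^ r * ((M : ℝ) ^ (1 - (α + δ * 2 ^ r)) * (1 + Real.log M) ^ (r + 1)) := by
  have hH : ∑ a ∈ Icc 1 M, (a : ℝ)⁻¹ ≤ 1 + Real.log M := by
    have := harmonic_le_one_add_log M
    rw [harmonic_eq_sum_Icc] at this
    push_cast at this
    exact this
  have hH0 : 0 ≤ ∑ a ∈ Icc 1 M, (a : ℝ)⁻¹ := sum_nonneg fun _ _ => by positivity
  calc ∑ x ∈ Icc 1 M ×ˢ Fintype.piFinset (fun _ : Fin r => Icc 1 M),
        ∏ S, (C * (cubePoint x.1 x.2 S : ℝ) ^ (-(α + δ)))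
      ≤ ∑ x ∈ Icc 1 M ×ˢ Fintype.piFinset (fun _ : Fin r => Icc 1 M),
          C ^ 2 ^ r * ((M : ℝ) ^ (1 - (α + δ * 2 ^ r)) * ((x.1 : ℝ)⁻¹ * ∏ i, (x.2 i : ℝ)⁻¹)) := by
        refine sum_le_sum fun x hx => ?_
        rw [mem_product, Fintype.mem_piFinset, mem_Icc] at hx
        have ha : (0 : ℝ) < x.1 := by exact_mod_cast hx.1.1
        have hd : ∀ i, 0 < x.2 i := fun i => (mem_Icc.1 (hx.2 i)).1
        rw [prod_mul_distrib, prod_const, card_univ, Fintype.card_finset, Fintype.card_fin]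
        refine mul_le_mul_of_nonneg_left ?_ (by positivity)
        refine (prod_rpow_neg_cubePoint_le hr hx.1.1 hd hα hδ).trans ?_
        rw [← mul_assoc]
        refine mul_le_mul_of_nonneg_right ?_ (prod_nonneg fun _ _ => by positivity)
        -- Splitting off 1/a lets `a` be summed like one more edge, hence r + 1 harmonic sums.
        have : (x.1 : ℝ) ^ (-(α + δ * 2 ^ r)) = (x.1 : ℝ) ^ (1 - (α + δ * 2 ^ r)) * (x.1 : ℝ)⁻¹ := by
          rw [← Real.rpow_neg_one, ← Real.rpow_add ha]; congr 1; ring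
        rw [this]
        refine mul_le_mul_of_nonneg_right ?_ (by positivity)
        exact Real.rpow_le_rpow ha.le (by exact_mod_cast hx.1.2) (by linarith)
    _ = C ^ 2 ^ r * ((M : ℝ) ^ (1 - (α + δ * 2 ^ r)) * (∑ a ∈ Icc 1 M, (a : ℝ)⁻¹) ^ (r + 1)) := by
        rw [← mul_sum, ← mul_sum, sum_product]
        simp only [← mul_sum]
        rw [← prod_univ_sum (fun _ : Fin r => Icc 1 M) (fun _ n => (n : ℝ)⁻¹), ← sum_mul,
          prod_const, card_univ, Fintype.card_fin, pow_succ']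
    _ ≤ _ := by gcongr

/-! ### Behrend's bound as a power, and a convergent series -/

theorem exp_mul_rpow_le_mul_exp_sqrt_log {δ x : ℝ} (hδ : 0 < δ) (hx : 1 ≤ x) :
    Real.exp (-(4 / δ)) * x ^ (1 - δ) ≤ x * Real.exp (-4 * √(Real.log x)) := by
  have hx' : 0 < x := by linarith
  have hsq := Real.sq_sqrt (Real.log_nonneg hx)
  generalize √(Real.log x) = s at *
  rw [sub_eq_add_neg, Real.rpow_add hx', Real.rpow_one, mul_left_comm]
  refine mul_le_mul_of_nonneg_left ?_ hx'.le
  rw [Real.rpow_def_of_pos hx', ← Real.exp_add, Real.exp_le_exp, ← hsq]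
  -- Completing the square yields 4s ≤ δs² + 4/δ.
  have h1 : 0 ≤ (δ * s - 2) ^ 2 / δ := by positivity
  have h2 : (δ * s - 2) ^ 2 / δ = δ * s ^ 2 - 4 * s + 4 / δ := by field_simp; ring
  linarith

theorem rpow_le_rothNumberNat {δ : ℝ} (hδ : 0 < δ) {N : ℕ} (hN : 0 < N) :
    Real.exp (-(4 / δ)) * (N : ℝ) ^ (1 - δ) ≤ rothNumberNat N :=
  (exp_mul_rpow_le_mul_exp_sqrt_log hδ (by exact_mod_cast hN)).trans Behrend.roth_lower_bound

theorem summable_succ_pow_mul_rpow_neg {δ : ℝ} (hδ : 0 < δ) (n : ℕ) :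
    Summable fun k : ℕ => ((k : ℝ) + 1) ^ n * ((4 : ℝ) ^ k) ^ (-δ) := by
  have hq1 : (4 : ℝ) ^ (-δ) < 1 := Real.rpow_lt_one_of_one_lt_of_neg (by norm_num) (by linarith)
  have hq0 : (0 : ℝ) < 4 ^ (-δ) := by positivity
  have hpow : ∀ k : ℕ, ((4 : ℝ) ^ k) ^ (-δ) = ((4 : ℝ) ^ (-δ)) ^ k := fun k => by
    rw [← Real.rpow_natCast, ← Real.rpow_natCast, ← Real.rpow_mul (by norm_num),
      ← Real.rpow_mul (by norm_num), mul_comm]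
  simp only [hpow]
  generalize (4 : ℝ) ^ (-δ) = q at hq0 hq1
  have hs := summable_pow_mul_geometric_of_norm_lt_one n
    (show ‖q‖ < 1 by rwa [Real.norm_of_nonneg hq0.le])
  have h := ((summable_nat_add_iff 1).2 hs).mul_left q⁻¹
  have he : (fun k : ℕ => q⁻¹ * (((k + 1 : ℕ) : ℝ) ^ n * q ^ (k + 1))) =
      fun k : ℕ => ((k : ℝ) + 1) ^ n * q ^ k := by
    funext k
    push_cast
    field_simp
    ring
  rwa [he] at h

/-! ### Selection and deletion in finitely many blocks -/

/-- Random selection followed by deletion of the highest point of every remaining cube. -/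
theorem exists_finset_cubeFree {r : ℕ} {B : ℕ → Finset ℕ}
    (hB : ∀ k, B k ⊆ Ico (2 * 4 ^ k) (3 * 4 ^ k))
    (hAP : ThreeAPFree (⋃ k, (B k : Set ℕ))) {s : ℕ → ℕ} (hs : ∀ k, 0 < s k)
    {p : ℕ → ℝ} (hp0 : ∀ n, 0 ≤ p n) (hp : ∀ k, ∀ n ∈ B k, 1 / (s k : ℝ) ≤ p n) {k₀ K : ℕ}
    (hsB : ∀ k ∈ Ico k₀ K, s k ≤ #(B k))
    (hsum : ∑ k ∈ Ico k₀ K, (1 / ((#(B k) / s k : ℕ) : ℝ)) *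
      ∑ x ∈ Icc 1 (3 * 4 ^ k) ×ˢ Fintype.piFinset (fun _ : Fin r => Icc 1 (3 * 4 ^ k)),
        ∏ S, p (cubePoint x.1 x.2 S) ≤ 1 / 2) :
    ∃ A : Finset ℕ, (∀ n ∈ A, ∃ k ∈ Ico k₀ K, n ∈ B k) ∧
      (∀ (a : ℕ) (d : Fin r → ℕ), (∀ i, 0 < d i) → ¬ ∀ S, cubePoint a d S ∈ A) ∧
      ∀ k ∈ Ico k₀ K, ((#(B k) / s k : ℕ) : ℝ) ≤ 2 * #(A ∩ B k) := by
  set m : ℕ → ℕ := fun k => #(B k) / s k with hm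
  have hBdisj : ∀ {k l n}, n ∈ B k → n ∈ B l → k = l := by
    intro k l n hk hl
    have hk' := mem_Ico.1 (hB k hk)
    have hl' := mem_Ico.1 (hB l hl)
    rcases lt_trichotomy k l with h | h | h
    · have : 4 ^ (k + 1) ≤ 4 ^ l := Nat.pow_le_pow_right (by norm_num) h
      rw [pow_succ] at this; omega
    · exact h
    · have : 4 ^ (l + 1) ≤ 4 ^ k := Nat.pow_le_pow_right (by norm_num) h
      rw [pow_succ] at this; omega
  have hgroups := fun k => exists_disjoint_subsets_card_eq (s k) (m k) (B k) (Nat.div_mul_le_self _ _)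
  choose G hGB hGs hGd using hgroups
  let ι := Σ k : Ico k₀ K, Fin (m k)
  let H : ι → Finset ℕ := fun i => G i.1 i.2
  have hHs : ∀ i, #(H i) = s i.1 := fun i => hGs i.1 i.2
  have hHB : ∀ i, H i ⊆ B i.1 := fun i => hGB i.1 i.2
  have hHne : ∀ i, (H i).Nonempty := fun i => card_pos.1 (by rw [hHs]; exact hs _)
  have hHd : ∀ i j, i ≠ j → Disjoint (H i) (H j) := by
    rintro ⟨k, i⟩ ⟨l, j⟩ hij
    by_cases hkl : k = l
    · subst hkl
      exact hGd k i j fun h => hij (by rw [h])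
    · refine disjoint_left.2 fun n h1 h2 => hkl ?_
      exact Subtype.ext (hBdisj (hHB ⟨k, i⟩ h1) (hHB ⟨l, j⟩ h2))
  let Q : ℕ → Finset (ℕ × (Fin r → ℕ)) := fun k =>
    {x ∈ Icc 1 (3 * 4 ^ k) ×ˢ Fintype.piFinset (fun _ : Fin r => Icc 1 (3 * 4 ^ k)) |
      Function.Injective (cubePoint x.1 x.2)}
  let E : Finset (Σ _ : ℕ, ℕ × (Fin r → ℕ)) := (Ico k₀ K).sigma Q
  let e : (Σ _ : ℕ, ℕ × (Fin r → ℕ)) → Finset ℕ := fun x =>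
    univ.image (cubePoint x.2.1 x.2.2)
  -- With weights 1/m_k, a total of at most 1/2 forces at most m_k/2 bad cubes for every k at once.
  obtain ⟨f, hf, hfle⟩ := exists_transversal_weight_le H hHne hHd p hp0
    (fun i n hn => by rw [hHs]; exact hp _ n (hHB i hn)) E e (fun x => 1 / (m x.1 : ℝ))
    (fun x => by positivity)
  have hbound : ∑ x ∈ E with e x ⊆ univ.image f, 1 / (m x.1 : ℝ) ≤ 1 / 2 := by
    refine hfle.trans (le_trans ?_ hsum)
    rw [sum_sigma]
    refine sum_le_sum fun k _ => ?_
    change ∑ x ∈ Q k, 1 / (m k : ℝ) * ∏ n ∈ univ.image (cubePoint x.1 x.2), p n ≤ _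
    rw [← mul_sum]
    refine mul_le_mul_of_nonneg_left ?_ (by positivity)
    calc ∑ x ∈ Q k, ∏ n ∈ univ.image (cubePoint x.1 x.2), p n
        = ∑ x ∈ Q k, ∏ S, p (cubePoint x.1 x.2 S) :=
          sum_congr rfl fun x hx => prod_image fun _ _ _ _ h => (mem_filter.1 hx).2 h
      _ ≤ _ := sum_le_sum_of_subset_of_nonneg (filter_subset _ _)
          fun _ _ _ => prod_nonneg fun _ _ => hp0 _
  let bad : ℕ → Finset (ℕ × (Fin r → ℕ)) := fun k =>
    {x ∈ Q k | univ.image (cubePoint x.1 x.2) ⊆ univ.image f}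
  let T : ℕ → Finset ℕ := fun k => (bad k).image fun x => cubePoint x.1 x.2 univ
  let I : Ico k₀ K → Finset ℕ := fun k => univ.image fun j : Fin (m k) => f ⟨k, j⟩
  have hbad : ∀ k ∈ Ico k₀ K, 2 * (#(bad k) : ℝ) ≤ m k := by
    intro k hk
    have h1 : (#(bad k) : ℝ) * (1 / (m k : ℝ)) ≤ 1 / 2 := by
      refine le_trans ?_ hbound
      rw [← nsmul_eq_mul, ← sum_const]
      have : ∑ x ∈ (bad k).map (Function.Embedding.sigmaMk (β := fun _ : ℕ => ℕ × (Fin r → ℕ)) k), 1 / (m x.1 : ℝ) = ∑ _x ∈ bad k, 1 / (m k : ℝ) := by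
        rw [sum_map]; rfl
      rw [← this]
      refine sum_le_sum_of_subset_of_nonneg ?_ fun _ _ _ => by positivity
      intro x hx
      obtain ⟨y, hy, rfl⟩ := mem_map.1 hx
      have hy' := mem_filter.1 hy
      exact mem_filter.2 ⟨mem_sigma.2 ⟨hk, hy'.1⟩, hy'.2⟩
    have h0 : (0 : ℝ) < m k := by exact_mod_cast Nat.div_pos (hsB k hk) (hs k)
    rw [mul_one_div, div_le_iff₀ h0] at h1
    linarith
  have hIB : ∀ k, I k ⊆ B k := by
    intro k n hn
    obtain ⟨j, -, rfl⟩ := mem_image.1 hn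
    exact hHB ⟨k, j⟩ (hf ⟨k, j⟩)
  have hIcard : ∀ k, #(I k) = m k := by
    intro k
    rw [card_image_of_injective, card_univ, Fintype.card_fin]
    intro i j hij
    by_contra hne
    have hne' : (⟨k, i⟩ : ι) ≠ ⟨k, j⟩ := fun h => hne (by simpa using h)
    refine disjoint_left.1 (hHd _ _ hne') (hf ⟨k, i⟩) ?_
    have : f ⟨k, i⟩ = f ⟨k, j⟩ := hij
    rw [this]; exact hf ⟨k, j⟩
  refine ⟨univ.biUnion fun k => I k \ T k, ?_, ?_, ?_⟩
  · intro n hn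
    obtain ⟨k, -, hk⟩ := mem_biUnion.1 hn
    exact ⟨k, k.2, hIB k (mem_sdiff.1 hk).1⟩
  · intro a d hd hcube
    have hmem : ∀ S, ∃ k : Ico k₀ K, cubePoint a d S ∈ I k \ T k := fun S => by
      obtain ⟨k, -, hk⟩ := mem_biUnion.1 (hcube S)
      exact ⟨k, hk⟩
    have hinj : Function.Injective (cubePoint a d) :=
      cubePoint_injective_of_threeAPFree hAP hd fun S => by
        obtain ⟨k, hk⟩ := hmem S
        exact Set.mem_iUnion.2 ⟨k, mem_coe.2 (hIB k (mem_sdiff.1 hk).1)⟩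
    obtain ⟨k, hk⟩ := hmem univ
    obtain ⟨l, hl⟩ := hmem ∅
    have hk' := mem_Ico.1 (hB k (hIB k (mem_sdiff.1 hk).1))
    have hl' := mem_Ico.1 (hB l (hIB l (mem_sdiff.1 hl).1))
    have ha : 0 < a := by
      have : 0 < 4 ^ (l : ℕ) := by positivity
      simp only [cubePoint, sum_empty] at hl'
      omega
    -- The cube is charged to the block of its top point, even if other points lie in lower blocks;
    -- `a` and all edges are then bounded by 3 * 4^k.
    refine (mem_sdiff.1 hk).2 (mem_image.2 ⟨(a, d), ?_, rfl⟩)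
    refine mem_filter.2 ⟨mem_filter.2 ⟨mem_product.2 ⟨?_, ?_⟩, hinj⟩, ?_⟩
    · simp only [cubePoint] at hk'
      exact mem_Icc.2 ⟨ha, by omega⟩
    · rw [Fintype.mem_piFinset]
      intro i
      have : d i ≤ ∑ i, d i := single_le_sum (f := d) (fun _ _ => Nat.zero_le _) (mem_univ i)
      simp only [cubePoint] at hk'
      exact mem_Icc.2 ⟨hd i, (by omega : d i ≤ 3 * 4 ^ (k : ℕ))⟩
    · intro n hn
      obtain ⟨S, -, rfl⟩ := mem_image.1 hn
      obtain ⟨j, hj⟩ := hmem S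
      obtain ⟨i, -, hi⟩ := mem_image.1 (mem_sdiff.1 hj).1
      exact mem_image.2 ⟨⟨j, i⟩, mem_univ _, hi⟩
  · intro k hk
    have h1 : I ⟨k, hk⟩ \ T k ⊆ (univ.biUnion fun k => I k \ T k) ∩ B k := by
      intro n hn
      exact mem_inter.2 ⟨mem_biUnion.2 ⟨⟨k, hk⟩, mem_univ _, hn⟩, hIB ⟨k, hk⟩ (mem_sdiff.1 hn).1⟩
    have h2 := card_le_card h1
    have h3 := le_card_sdiff (T k) (I ⟨k, hk⟩)
    have h4 : #(T k) ≤ #(bad k) := card_image_le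
    rw [hIcard] at h3
    have h5 : (m k : ℝ) ≤ #(bad k) + #((univ.biUnion fun k => I k \ T k) ∩ B k) := by
      have : m k ≤ #(bad k) + #((univ.biUnion fun k => I k \ T k) ∩ B k) := by
        have h6 : m k - #(T k) ≤ #(I ⟨k, hk⟩ \ T k) := h3
        omega
      exact_mod_cast this
    have h6 := hbad k hk
    have h7 : (m k : ℝ) ≤ 2 * #((univ.biUnion fun k => I k \ T k) ∩ B k) := by linarith
    exact h7

/-! ### Passage to an infinite set -/

/-- Compactness: membership in the limit is membership in `A K` for almost all K along a
nonprincipal ultrafilter. Both a cube and a block are finite, so each is decided at a single K. -/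
theorem exists_set_cubeFree_of_finset {r : ℕ} {B : ℕ → Finset ℕ} {k₀ : ℕ} {b : ℕ → ℝ}
    (h : ∀ K, ∃ A : Finset ℕ, (∀ n ∈ A, ∃ k ∈ Ico k₀ K, n ∈ B k) ∧
      (∀ (a : ℕ) (d : Fin r → ℕ), (∀ i, 0 < d i) → ¬ ∀ S, cubePoint a d S ∈ A) ∧
      ∀ k ∈ Ico k₀ K, b k ≤ #(A ∩ B k)) :
    ∃ A : Set ℕ, (∀ n ∈ A, ∃ k, n ∈ B k) ∧
      (∀ (a : ℕ) (d : Fin r → ℕ), (∀ i, 0 < d i) → ¬ ∀ S, cubePoint a d S ∈ A) ∧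
      ∀ k, k₀ ≤ k → b k ≤ ((A ∩ B k).ncard : ℝ) := by
  choose A h1 h2 h3 using h
  refine ⟨{n | ∀ᶠ K in (Filter.hyperfilter ℕ : Filter ℕ), n ∈ A K}, ?_, ?_, ?_⟩
  · intro n hn
    obtain ⟨K, hK⟩ := Filter.Eventually.exists hn
    obtain ⟨k, -, hk⟩ := h1 K n hK
    exact ⟨k, hk⟩
  · intro a d hd hcube
    obtain ⟨K, hK⟩ := (Filter.eventually_all.2 hcube).exists
    exact h2 K a d hd hK
  · intro k hk
    have hev : ∀ᶠ K in (Filter.hyperfilter ℕ : Filter ℕ), ∀ n ∈ B k, n ∈ A K →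
        ∀ᶠ K in (Filter.hyperfilter ℕ : Filter ℕ), n ∈ A K := by
      rw [Filter.eventually_all_finset]
      intro n _
      by_cases hn : ∀ᶠ K in (Filter.hyperfilter ℕ : Filter ℕ), n ∈ A K
      · exact Filter.Eventually.of_forall fun _ _ => hn
      · filter_upwards [Ultrafilter.eventually_not.2 hn] with K hK h
        exact absurd h hK
    have hgt : ∀ᶠ K in (Filter.hyperfilter ℕ : Filter ℕ), k < K := by
      refine Filter.Eventually.filter_mono Filter.hyperfilter_le_cofinite ?_
      rw [Nat.cofinite_eq_atTop]
      exact Filter.eventually_gt_atTop k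
    obtain ⟨K, hK, hkK⟩ := (hev.and hgt).exists
    refine (h3 K k (mem_Ico.2 ⟨hk, hkK⟩)).trans ?_
    rw [← Set.ncard_coe_finset]
    have : ((A K ∩ B k : Finset ℕ) : Set ℕ).ncard ≤
        ({n | ∀ᶠ K in (Filter.hyperfilter ℕ : Filter ℕ), n ∈ A K} ∩ (B k : Set ℕ)).ncard := by
      refine Set.ncard_le_ncard ?_ ((B k).finite_toSet.subset Set.inter_subset_right)
      intro n hn
      have hn' := mem_inter.1 (mem_coe.1 hn)
      exact ⟨hK n hn'.2 hn'.1, hn'.2⟩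
    exact_mod_cast this

/-! ### Choice of parameters -/

theorem exists_blocks_threeAPFree :
    ∃ B : ℕ → Finset ℕ, (∀ k, B k ⊆ Ico (2 * 4 ^ k) (3 * 4 ^ k)) ∧
      ThreeAPFree (⋃ k, (B k : Set ℕ)) ∧ ∀ k, #(B k) = rothNumberNat (4 ^ k) := by
  choose t ht hcard hfree using fun k : ℕ => rothNumberNat_spec (4 ^ k)
  have hB : ∀ k, (t k).map (addLeftEmbedding (2 * 4 ^ k)) ⊆ Ico (2 * 4 ^ k) (3 * 4 ^ k) := by
    intro k n hn
    obtain ⟨x, hx, rfl⟩ := mem_map.1 hn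
    have := mem_range.1 (ht k hx)
    simp only [addLeftEmbedding_apply, mem_Ico]
    omega
  refine ⟨_, hB, threeAPFree_iUnion_blocks hB fun k => ?_, fun k => by rw [card_map, hcard]⟩
  rw [coe_map]
  exact (hfree k).vadd_set (a := 2 * 4 ^ k)

theorem exists_le_rothNumberNat_div_ceil {γ δ : ℝ} (hγ : 0 ≤ γ) (hδ : 0 < δ)
    (hβ : 0 < 1 - γ - δ) :
    ∃ c : ℝ, 0 < c ∧ ∃ k₁ : ℕ, ∀ k ≥ k₁, c * ((4 : ℝ) ^ k) ^ (1 - γ - δ) ≤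
      ((rothNumberNat (4 ^ k) / ⌈((4 : ℝ) ^ k) ^ γ⌉₊ : ℕ) : ℝ) := by
  set C := Real.exp (-(4 / δ)) with hC
  have hC0 : 0 < C := Real.exp_pos _
  have htend : Filter.Tendsto (fun k : ℕ => ((4 : ℝ) ^ k) ^ (1 - γ - δ)) Filter.atTop
      Filter.atTop :=
    (tendsto_rpow_atTop hβ).comp (tendsto_pow_atTop_atTop_of_one_lt (by norm_num))
  -- Beyond 4/C, rounding down the quotient costs at most a factor 2, as does rounding up the group
  -- size; hence C/4.
  obtain ⟨k₁, hk₁⟩ := Filter.eventually_atTop.1 (htend.eventually_ge_atTop (4 / C))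
  refine ⟨C / 4, by positivity, k₁, fun k hk => ?_⟩
  have h1 := hk₁ k hk
  have hroth := rpow_le_rothNumberNat hδ (N := 4 ^ k) (by positivity)
  push_cast at hroth
  rw [← hC] at hroth
  generalize rothNumberNat (4 ^ k) = b at hroth ⊢
  have hN : (1 : ℝ) ≤ 4 ^ k := one_le_pow₀ (by norm_num)
  generalize (4 : ℝ) ^ k = N at *
  have hN0 : 0 < N := by linarith
  have hNγ : 1 ≤ N ^ γ := Real.one_le_rpow hN hγ
  have hs : (⌈N ^ γ⌉₊ : ℝ) ≤ 2 * N ^ γ := by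
    have := Nat.ceil_lt_add_one (show 0 ≤ N ^ γ by linarith)
    linarith
  have hs0 : 0 < ⌈N ^ γ⌉₊ := Nat.ceil_pos.2 (by linarith)
  generalize ⌈N ^ γ⌉₊ = s at *
  have hdiv : (b : ℝ) < s * ((b / s : ℕ) + 1) := by exact_mod_cast Nat.lt_mul_div_succ b hs0
  have hsplit : N ^ (1 - δ) = N ^ γ * N ^ (1 - γ - δ) := by
    rw [← Real.rpow_add hN0]; congr 1; ring
  rw [hsplit] at hroth
  have h2 : C * (N ^ γ * N ^ (1 - γ - δ)) < 2 * N ^ γ * ((b / s : ℕ) + 1) :=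
    hroth.trans_lt (hdiv.trans_le (mul_le_mul_of_nonneg_right hs (by positivity)))
  have h3 : C * N ^ (1 - γ - δ) < 2 * ((b / s : ℕ) + 1) := by
    refine lt_of_mul_lt_mul_left ?_ (show 0 ≤ N ^ γ by linarith)
    linarith
  rw [div_le_iff₀ hC0] at h1
  linarith

theorem exists_forall_sum_Ico_le {g : ℕ → ℝ} (hg : Summable g) {η : ℝ} (hη : 0 < η) :
    ∃ k₂ : ℕ, ∀ k₀ ≥ k₂, ∀ K, ∑ k ∈ Ico k₀ K, g k ≤ η := by
  obtain ⟨s, hs⟩ := summable_iff_vanishing_norm.1 hg η hη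
  refine ⟨s.sup id + 1, fun k₀ hk₀ K => ?_⟩
  refine (le_abs_self _).trans (hs _ (disjoint_left.2 fun k hk hks => ?_)).le
  have : k ≤ s.sup id := le_sup (f := id) hks
  have := (mem_Ico.1 hk).1
  omega

theorem one_add_log_le (k : ℕ) : 1 + Real.log ((3 * 4 ^ k : ℕ) : ℝ) ≤ 3 * ((k : ℝ) + 1) := by
  push_cast
  rw [Real.log_mul (by norm_num) (by positivity), Real.log_pow]
  have h3 := Real.log_le_sub_one_of_pos (show (0 : ℝ) < 3 by norm_num)
  have h4 := Real.log_le_sub_one_of_pos (show (0 : ℝ) < 4 by norm_num)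
  nlinarith [Nat.cast_nonneg (α := ℝ) k]

theorem cube_sum_div_le {r : ℕ} (hr : 2 ≤ r) {α δ c μ : ℝ} (hα0 : 0 ≤ α) (hδ : 0 < δ)
    (hc : 0 < c) {k : ℕ}
    (hμ : c * ((4 : ℝ) ^ k) ^ (1 - (α + δ) - δ) ≤ μ) :
    (1 / μ) * ((3 : ℝ) ^ 2 ^ r * (((3 * 4 ^ k : ℕ) : ℝ) ^ (1 - (α + δ * 2 ^ r)) *
        (1 + Real.log ((3 * 4 ^ k : ℕ) : ℝ)) ^ (r + 1))) ≤
      c⁻¹ * 3 ^ 2 ^ r * 3 * 3 ^ (r + 1) * (((k : ℝ) + 1) ^ (r + 1) * ((4 : ℝ) ^ k) ^ (-δ)) := by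
  have hlog := one_add_log_le k
  have hlog0 : 0 ≤ 1 + Real.log ((3 * 4 ^ k : ℕ) : ℝ) := by
    have := Real.log_natCast_nonneg (3 * 4 ^ k)
    linarith
  have hpow := pow_le_pow_left₀ hlog0 hlog (r + 1)
  rw [mul_pow] at hpow
  generalize (1 + Real.log ((3 * 4 ^ k : ℕ) : ℝ)) ^ (r + 1) = Λ at hpow
  push_cast
  have hN : (1 : ℝ) ≤ 4 ^ k := one_le_pow₀ (by norm_num)
  generalize (4 : ℝ) ^ k = N at *
  have hN0 : 0 < N := by linarith
  have h2r : (4 : ℝ) ≤ 2 ^ r := by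
    have := pow_le_pow_right₀ (one_le_two (α := ℝ)) hr
    norm_num at this
    exact this
  have hμ0 : 0 < c * N ^ (1 - (α + δ) - δ) := by positivity
  have h1 : 1 / μ ≤ c⁻¹ * (N ^ (1 - (α + δ) - δ))⁻¹ := by
    rw [← mul_inv, ← one_div]
    exact one_div_le_one_div_of_le hμ0 hμ
  have h2 : (3 * N) ^ (1 - (α + δ * 2 ^ r)) ≤ 3 * (N ^ (1 - (α + δ) - δ) * N ^ (-δ)) := by
    rw [Real.mul_rpow (by norm_num) hN0.le, ← Real.rpow_add hN0]
    refine mul_le_mul ?_ ?_ (by positivity) (by norm_num)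
    · calc (3 : ℝ) ^ (1 - (α + δ * 2 ^ r)) ≤ 3 ^ (1 : ℝ) :=
            Real.rpow_le_rpow_of_exponent_le (by norm_num) (by nlinarith)
        _ = 3 := Real.rpow_one _
    -- Only 2^r ≥ 3 matters: two δ are lost in the size of the selection and a third gives the
    -- decay.
    · exact Real.rpow_le_rpow_of_exponent_le hN (by nlinarith)
  have hmul : (3 * N) ^ (1 - (α + δ * 2 ^ r)) * Λ ≤
      3 * (N ^ (1 - (α + δ) - δ) * N ^ (-δ)) * (3 ^ (r + 1) * ((k : ℝ) + 1) ^ (r + 1)) :=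
    (mul_le_mul_of_nonneg_left hpow (by positivity)).trans
      (mul_le_mul_of_nonneg_right h2 (by positivity))
  have hne : N ^ (1 - (α + δ) - δ) ≠ 0 := by positivity
  calc _ ≤ (1 / μ) * ((3 : ℝ) ^ 2 ^ r * (3 * (N ^ (1 - (α + δ) - δ) * N ^ (-δ)) *
          (3 ^ (r + 1) * ((k : ℝ) + 1) ^ (r + 1)))) := by
        have : 0 ≤ 1 / μ := by
          have := hμ0.trans_le hμ
          positivity
        exact mul_le_mul_of_nonneg_left (mul_le_mul_of_nonneg_left hmul (by positivity)) this
    _ ≤ (c⁻¹ * (N ^ (1 - (α + δ) - δ))⁻¹) * ((3 : ℝ) ^ 2 ^ r *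
          (3 * (N ^ (1 - (α + δ) - δ) * N ^ (-δ)) * (3 ^ (r + 1) * ((k : ℝ) + 1) ^ (r + 1)))) :=
        mul_le_mul_of_nonneg_right h1 (by positivity)
    _ = _ := by field_simp

/-- Replaces the block-dependent probability by a single function of n, so that cubes spread over
several blocks are treated uniformly. -/
theorem le_mul_rpow_neg_of_mem_block {γ : ℝ} (hγ0 : 0 ≤ γ) (hγ1 : γ ≤ 1) {n k : ℕ}
    (hn0 : 0 < n) (hn : n < 3 * 4 ^ k) :
    1 / (⌈((4 : ℝ) ^ k) ^ γ⌉₊ : ℝ) ≤ 3 * (n : ℝ) ^ (-γ) := by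
  have hn' : (n : ℝ) ≤ 3 * 4 ^ k := by exact_mod_cast hn.le
  have hN : (0 : ℝ) < 4 ^ k := by positivity
  generalize (4 : ℝ) ^ k = N at *
  have hn0' : (0 : ℝ) < n := by exact_mod_cast hn0
  have hpos : 0 < N ^ γ := by positivity
  refine (one_div_le_one_div_of_le hpos (Nat.le_ceil _)).trans ?_
  have h1 : (n : ℝ) ^ γ ≤ 3 * N ^ γ := by
    calc (n : ℝ) ^ γ ≤ (3 * N) ^ γ := Real.rpow_le_rpow hn0'.le hn' hγ0
      _ = 3 ^ γ * N ^ γ := Real.mul_rpow (by norm_num) hN.le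
      _ ≤ 3 ^ (1 : ℝ) * N ^ γ := mul_le_mul_of_nonneg_right
          (Real.rpow_le_rpow_of_exponent_le (by norm_num) hγ1) hpos.le
      _ = 3 * N ^ γ := by rw [Real.rpow_one]
  rw [Real.rpow_neg hn0'.le, ← div_eq_mul_inv, div_le_div_iff₀ hpos (by positivity)]
  linarith

theorem exists_set_cubeFree {r : ℕ} (hr : 2 ≤ r) {α δ : ℝ} (hα : α = r / ((2 : ℝ) ^ r - 1))
    (hδ : 0 < δ) (hu : α + δ * 2 ^ r ≤ 1) :
    ∃ A : Set ℕ, (∀ n ∈ A, 0 < n) ∧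
      (∀ (a : ℕ) (d : Fin r → ℕ), (∀ i, 0 < d i) → ¬ ∀ S, cubePoint a d S ∈ A) ∧
      ∃ c : ℝ, 0 < c ∧ ∃ k₀ : ℕ, ∀ k ≥ k₀, c * ((4 : ℝ) ^ k) ^ (1 - α - 2 * δ) ≤
        ((A ∩ Set.Ico (2 * 4 ^ k) (3 * 4 ^ k)).ncard : ℝ) := by
  have h2r : (4 : ℝ) ≤ 2 ^ r := by
    have := pow_le_pow_right₀ (one_le_two (α := ℝ)) hr
    norm_num at this
    exact this
  have hα0 : 0 ≤ α := by
    rw [hα]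
    exact div_nonneg (by positivity) (by linarith)
  have h4δ : α + 4 * δ ≤ 1 := by nlinarith
  obtain ⟨B, hB, hAP, hcard⟩ := exists_blocks_threeAPFree
  obtain ⟨c, hc, k₁, hk₁⟩ := exists_le_rothNumberNat_div_ceil (γ := α + δ) (by linarith) hδ
    (by linarith)
  obtain ⟨k₂, hk₂⟩ := exists_forall_sum_Ico_le
    ((summable_succ_pow_mul_rpow_neg hδ (r + 1)).mul_left
      (c⁻¹ * 3 ^ 2 ^ r * 3 * 3 ^ (r + 1))) (show (0 : ℝ) < 1 / 2 by norm_num)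
  set s : ℕ → ℕ := fun k => ⌈((4 : ℝ) ^ k) ^ (α + δ)⌉₊ with hs
  have hs0 : ∀ k, 0 < s k := fun k => Nat.ceil_pos.2 (by positivity)
  have hm : ∀ k ≥ k₁, c * ((4 : ℝ) ^ k) ^ (1 - (α + δ) - δ) ≤ ((#(B k) / s k : ℕ) : ℝ) := by
    intro k hk
    rw [hcard]
    exact hk₁ k hk
  have hfin := fun K => exists_finset_cubeFree (r := r) hB hAP hs0
    (p := fun n => 3 * (n : ℝ) ^ (-(α + δ))) (fun n => by positivity)
    (fun k n hn => by
      have hn' := mem_Ico.1 (hB k hn)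
      have : 0 < 4 ^ k := by positivity
      exact le_mul_rpow_neg_of_mem_block (by linarith) (by linarith) (by omega) hn'.2)
    (k₀ := max k₁ k₂) (K := K)
    (fun k hk => by
      have h1 := hm k ((le_max_left _ _).trans (mem_Ico.1 hk).1)
      have h2 : (0 : ℝ) < ((#(B k) / s k : ℕ) : ℝ) := lt_of_lt_of_le (by positivity) h1
      exact (Nat.div_pos_iff.1 (by exact_mod_cast h2)).2)
    (by
      refine le_trans (sum_le_sum fun k hk => ?_) (hk₂ (max k₁ k₂) (le_max_right _ _) K)
      refine le_trans (mul_le_mul_of_nonneg_left (sum_prod_cubePoint_le (by omega) hα hδ.le hu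
        (3 * 4 ^ k) 3 (by norm_num)) (by positivity)) ?_
      exact cube_sum_div_le hr hα0 hδ hc (hm k ((le_max_left _ _).trans (mem_Ico.1 hk).1)))
  obtain ⟨A, hA1, hA2, hA3⟩ := exists_set_cubeFree_of_finset (r := r) (B := B)
    (k₀ := max k₁ k₂) (b := fun k => c / 2 * ((4 : ℝ) ^ k) ^ (1 - α - 2 * δ)) (fun K => by
      obtain ⟨A, h1, h2, h3⟩ := hfin K
      refine ⟨A, h1, h2, fun k hk => ?_⟩
      have h4 := hm k ((le_max_left _ _).trans (mem_Ico.1 hk).1)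
      have h5 := h3 k hk
      have h6 : 1 - (α + δ) - δ = 1 - α - 2 * δ := by ring
      rw [h6] at h4
      linarith)
  refine ⟨A, fun n hn => ?_, hA2, c / 2, by positivity, max k₁ k₂, fun k hk => ?_⟩
  · obtain ⟨k, hk⟩ := hA1 n hn
    have := mem_Ico.1 (hB k hk)
    have : 0 < 4 ^ k := by positivity
    omega
  · refine (hA3 k hk).trans ?_
    have : (A ∩ B k).ncard ≤ (A ∩ Set.Ico (2 * 4 ^ k) (3 * 4 ^ k)).ncard := by
      refine Set.ncard_le_ncard ?_ ((Set.finite_Ico _ _).subset Set.inter_subset_right)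
      refine Set.inter_subset_inter_right _ fun n hn => ?_
      have := mem_Ico.1 (hB k hn)
      exact this
    exact_mod_cast this

/-! ### Conclusion -/

theorem theorem7 (r : ℕ) (hr : 2 ≤ r) (ε : ℝ) (hε : 0 < ε) :
    ∃ A : Set ℤ, (∀ a ∈ A, 0 < a) ∧ A.Infinite ∧ IsHilbertCubeFree r A ∧
      ∃ c : ℝ, 0 < c ∧ ∀ᶠ x : ℝ in Filter.atTop,
        c * x ^ (1 - (r : ℝ) / ((2 : ℝ) ^ r - 1) - ε) ≤ (countingFun A x : ℝ) := by
  set α : ℝ := r / ((2 : ℝ) ^ r - 1) with hα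
  have hlt : α < 1 := by
    have h1 : r + 1 < 2 ^ r := by
      clear hα
      induction r, hr using Nat.le_induction with
      | base => norm_num
      | succ n hn ih => rw [pow_succ]; omega
    have h2 : (r : ℝ) + 1 < 2 ^ r := by exact_mod_cast h1
    rw [hα, div_lt_one (by linarith [Nat.cast_nonneg (α := ℝ) r])]
    linarith
  -- The first bound absorbs the loss 2δ into ε; the second keeps 1 - α - 2^r δ nonnegative.
  set δ : ℝ := min (ε / 2) ((1 - α) / 2 ^ r) with hδ
  have hδ0 : 0 < δ := lt_min (by linarith) (div_pos (by linarith) (by positivity))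
  have hδε : 2 * δ ≤ ε := by have := min_le_left (ε / 2) ((1 - α) / 2 ^ r); linarith
  have hδu : α + δ * 2 ^ r ≤ 1 := by
    have := min_le_right (ε / 2) ((1 - α) / 2 ^ r)
    rw [← hδ, le_div_iff₀ (by positivity)] at this
    linarith
  obtain ⟨A, hpos, hfree, c, hc, k₀, hk₀⟩ := exists_set_cubeFree hr hα hδ0 hδu
  refine ⟨(fun n : ℕ => (n : ℤ)) '' A, ?_, ?_, isHilbertCubeFree_image_natCast hfree,
    c * (12 : ℝ) ^ (-(1 - α - 2 * δ)), by positivity, ?_⟩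
  · rintro _ ⟨n, hn, rfl⟩
    exact Int.natCast_pos.2 (hpos n hn)
  · refine Set.Infinite.image Nat.cast_injective.injOn ?_
    refine Set.infinite_of_forall_exists_gt fun n => ?_
    have h1 := hk₀ (max n k₀) (le_max_right _ _)
    have h2 : 0 < (A ∩ Set.Ico (2 * 4 ^ max n k₀) (3 * 4 ^ max n k₀)).ncard := by
      have : (0 : ℝ) < c * ((4 : ℝ) ^ max n k₀) ^ (1 - α - 2 * δ) := by positivity
      exact_mod_cast this.trans_le h1
    obtain ⟨m, hmA, hm⟩ := Set.nonempty_of_ncard_ne_zero h2.ne'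
    refine ⟨m, hmA, ?_⟩
    have h3 : max n k₀ < 4 ^ max n k₀ := Nat.lt_pow_self (by norm_num)
    have h4 := hm.1
    have h5 := le_max_left n k₀
    omega
  · filter_upwards [Filter.eventually_ge_atTop (3 * (4 : ℝ) ^ k₀)] with x hx
    have h4k : (1 : ℝ) ≤ 4 ^ k₀ := one_le_pow₀ (by norm_num)
    -- The k-th block ends at 3 * 4^k ≤ x, while 4^k > x/12: hence the constant 12.
    obtain ⟨k, hk1, hk2⟩ := exists_nat_pow_near (x := x / 3) (y := 4) (by linarith) (by norm_num)
    have hk : k₀ ≤ k := by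
      have : (4 : ℝ) ^ k₀ < 4 ^ (k + 1) := lt_of_le_of_lt (by linarith) hk2
      have := (pow_lt_pow_iff_right₀ (by norm_num : (1 : ℝ) < 4)).1 this
      omega
    have hβ : 0 ≤ 1 - α - 2 * δ := by
      have h2r : (2 : ℝ) ≤ 2 ^ r := by
        have := pow_le_pow_right₀ (one_le_two (α := ℝ)) (show 1 ≤ r by omega)
        linarith
      nlinarith
    have hx1 : 1 ≤ x := by linarith
    have hcount : (A ∩ Set.Ico (2 * 4 ^ k) (3 * 4 ^ k)).ncard ≤
        countingFun ((fun n : ℕ => (n : ℤ)) '' A) x := by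
      rw [countingFun, ← Set.ncard_image_of_injective _ (Nat.cast_injective (R := ℤ))]
      refine Set.ncard_le_ncard ?_ ((Set.finite_Icc (1 : ℤ) ⌊x⌋).subset ?_)
      · rintro _ ⟨n, ⟨hnA, hn⟩, rfl⟩
        refine ⟨⟨n, hnA, rfl⟩, by exact_mod_cast hpos n hnA, ?_⟩
        have : (n : ℝ) ≤ 3 * 4 ^ k := by exact_mod_cast hn.2.le
        push_cast
        linarith
      · rintro a ⟨-, h1, h2⟩
        exact ⟨h1, Int.le_floor.2 h2⟩
    calc c * (12 : ℝ) ^ (-(1 - α - 2 * δ)) * x ^ (1 - α - ε)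
        ≤ c * (12 : ℝ) ^ (-(1 - α - 2 * δ)) * x ^ (1 - α - 2 * δ) :=
          mul_le_mul_of_nonneg_left
            (Real.rpow_le_rpow_of_exponent_le hx1 (by linarith)) (by positivity)
      _ = c * (x / 12) ^ (1 - α - 2 * δ) := by
          rw [Real.div_rpow (by linarith) (by norm_num), Real.rpow_neg (by norm_num)]
          ring
      _ ≤ c * ((4 : ℝ) ^ k) ^ (1 - α - 2 * δ) := by
          refine mul_le_mul_of_nonneg_left (Real.rpow_le_rpow (by linarith) ?_ hβ) hc.le
          rw [pow_succ] at hk2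
          linarith
      _ ≤ _ := (hk₀ k hk).trans (by exact_mod_cast hcount)
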